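/- **Setting.** Let $K$, $A$, $B$ be finite sets, $A,B\neq\emptyset$. For $k\in K$ let $M_k\in\mathbb R^{|A|\times|B|}$, and for $a\in A$ let $Q_a\in\mathbb R^{|K|\times|K|}$ be a stochastic matrix. In the $N$-stage primal game $\Gamma_N(p)$, $N\ge 1$, $p\in\Delta(K)$, the state $k_1$ is drawn from $p$ and $k_{t+1}$ from $Q_{a_t}(k_t,:)$; at each stage $t\le N$ player 1 (informed, the maximizer) chooses $a_t\in A$ by a behavior strategy depending on $k_1,\dots,k_t$ and on the past actions of both players, while player 2 (uninformed, the minimizer) simultaneously chooses $b_t\in B$ by a behavior strategy depending on the past actions of both players only. The payoff is $\gamma_N=\mathbf E\big[\sum_{t=1}^N M_{k_t}(a_t,b_t)\big]$. In the dual game $G_N(\alpha)$, $\alpha\in\mathbb R^{|K|}$, player 1 also chooses the distribution $p\in\Delta(K)$ of $k_1$, and the payoff is $\mathbf E\big[\alpha(k_1)+\sum_{t=1}^N M_{k_t}(a_t,b_t)\big]$; its value (maxmin $=$ minmax) is $w_N(\alpha)$. A strategy of player 2 is a security strategy if it guarantees that the payoff never exceeds the minmax value. A vector $\hat\alpha_1\in\mathbb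 R^{|K|}$ is a *regret at stage 1* of $\Gamma_N(p)$ if it minimizes $\alpha\mapsto w_N(\alpha)-p^T\alpha$ over $\mathbb R^{|K|}$. If $\hat y^*\in\Delta(B)$ and $(\beta^*_a)_{a\in A}\in(\mathbb R^{|K|})^A$ form an optimal solution of $$\min_{\hat y\in\Delta(B)}\ \min_{(\beta_a)_{a\in A}}\ \max_{\Pi\in\Delta(K\times A)}\ \sum_{k,a}\Pi(k,a)\big(M_k(a,:)\hat y+\hat\alpha_1(k)-Q_a(k,:)\beta_a+w_{N-1}(\beta_a)\big),\qquad N\ge 2,$$ then $\beta^*_a$ is called the *regret at stage 2* after player 1's action $a$. **Theorem.** Let $n\ge1$, $p\in\Delta(K)$, and let $\hat\alpha_1$ be a regret at stage 1 of the primal game $\Gamma_{n+1}(p)$. The dual game $G_{n+1}(\hat\alpha_1)$ has a value $w_{n+1}(\hat\alpha_1)$, and it equals the (attained) optimum of the linear program $$\min\ \tilde\ell$$ in the variables $\hat y\in\Delta(B)$, $\beta_a\in\mathbb R^{|K|}$, $\tilde\ell\in\mathbb R$, $\hat\ell_a\in\mathbb R$, $y_{a,I_t}\in\Delta(B)$ and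 $\ell_{a,F_t}\in\mathbb R$ (for $a\in A$, $t=1,\dots,n$, $I_t=(a_1,\dots,a_{t-1})\in A^{t-1}$, and $F_t=((k_1,\dots,k_t),(a_1,\dots,a_{t-1}))\in K^t\times A^{t-1}$), subject to $$M_k(a,:)\hat y+\hat\alpha_1(k)-Q_a(k,:)\beta_a+\hat\ell_a\le\tilde\ell\qquad\forall a\in A,\ k\in K,$$ $$\beta_a(k)+\ell_{a,F_1}\le\hat\ell_a\quad\text{with }F_1=(k)\qquad\forall a\in A,\ k\in K,$$ $$\sum_{k_t\in K}\ell_{a,F_t}\le\ell_{a,F_{t-1}}\quad\text{with }F_t=(F_{t-1},(k_t,a_{t-1}))\qquad\forall a\in A,\ 2\le t\le n,\ F_{t-1}\in K^{t-1}\times A^{t-2},\ a_{t-1}\in A,$$ $$\prod_{t=1}^{n-1}Q_{a_t}(k_t,k_{t+1})\sum_{t=1}^nM_{k_t}(a_t,:)\,y_{a,I_t}\le\ell_{a,F_n}\qquad\forall a\in A,\ F_n\in K^n\times A^{n-1},\ a_n\in A.$$ Moreover, for every optimal solution of this program: 1. player 2 has a strategy whose first-stage mixed action is $\hat y^*$ and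 which is a security strategy both in $G_{n+1}(\hat\alpha_1)$ and in $\Gamma_{n+1}(p)$; 2. $(\hat y^*,(\beta^*_a)_{a\in A})$ is an optimal solution of the min-max problem above with $N=n+1$, i.e. $\beta^*_a$ is the regret at stage 2 after player 1's action $a$. The size of the program is linear in $|B|$: it has $$\Big(1+|A|\sum_{t=0}^{n-1}|A|^t\Big)|B|+|A||K|+1+|A|+|A|\sum_{t=0}^{n-1}|K|^{t+1}|A|^t$$ variables, and, counting also the constraints that define $\hat y,y_{a,I_t}\in\Delta(B)$ (nonnegativity of each coordinate, and sum equal to one), $$\Big(1+|A|\sum_{t=0}^{n-1}|A|^t\Big)|B|+2|A||K|+|A|\sum_{t=0}^{n-1}(|K||A|)^{t+1}+1+|A|\sum_{t=0}^{n-1}|A|^t$$ constraints. -/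

import Mathlib

/-- The data of a zero-sum stochastic game with state set `K`, action sets `A` (player 1, informed)
and `B` (player 2, uninformed): payoff matrices `M k` (paid to player 1 by player 2) and transition
matrices `Q a`, controlled by player 1 only. The initial distribution is supplied separately. -/
structure StochGame (K A B : Type*) [Fintype K] where
  M : K → Matrix A B ℝ
  Q : A → Matrix K K ℝ
  Q_mem : ∀ a k, Q a k ∈ stdSimplex ℝ K

/-! ### Abstract zero-sum games: the first player maximizes, the second one minimizes -/

/-- The minmax value `min_t max_s g(s,t)`. -/
noncomputable def upperValue {S T : Type*} (g : S → T → ℝ) : ℝ := ⨅ t, ⨆ s, g s t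

/-- `v` is the value of the game: `max_s min_t g(s,t) = v = min_t max_s g(s,t)`, where the outer
maximum and the outer minimum are attained. -/
def HasValue {S T : Type*} (g : S → T → ℝ) (v : ℝ) : Prop :=
  (∃ s, ∀ t, v ≤ g s t) ∧ (∃ t, ∀ s, g s t ≤ v)

/-- `t` is a security strategy of the minimizing player: it guarantees the minmax value. -/
def IsSecurityStrategy {S T : Type*} (g : S → T → ℝ) (t : T) : Prop :=
  ∀ s, g s t ≤ upperValue g

/-! ### Behavior strategies, plays and payoffs

Stages are indexed by `Fin N`, stage `t` being the `(t+1)`-st one. -/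

/-- Behavior strategies of player 1: at each stage a mixed action depending on the states up to and
including the current one and on the past actions of both players. -/
abbrev InformedStrategy (K A B : Type*) [Fintype A] (N : ℕ) : Type _ :=
  (t : Fin N) → (Fin (t + 1) → K) → (Fin t → A) → (Fin t → B) → stdSimplex ℝ A

/-- Behavior strategies of player 2: at each stage a mixed action depending on the past actions of
both players. -/
abbrev UninformedStrategy (A B : Type*) [Fintype B] (N : ℕ) : Type _ :=
  (t : Fin N) → (Fin t → A) → (Fin t → B) → stdSimplex ℝ B

namespace StochGame

variable {K A B : Type*} [Fintype K] [Fintype A] [Fintype B]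

/-- The stage before `t` (only used when `t` is not the first stage). -/
def prevStage {N : ℕ} (t : Fin N) : Fin N := ⟨(t : ℕ) - 1, (Nat.sub_le _ _).trans_lt t.isLt⟩

/-- Probability with which nature draws the state of stage `t` on the play with states `κ` and
player 1's actions `a`. -/
noncomputable def stateProb (G : StochGame K A B) {N : ℕ} (p : K → ℝ)
    (κ : Fin N → K) (a : Fin N → A) (t : Fin N) : ℝ :=
  if (t : ℕ) = 0 then p (κ t) else G.Q (a (prevStage t)) (κ (prevStage t)) (κ t)

/-- Probability of the play with states `κ` and actions `a`, `b`. -/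
noncomputable def playProb (G : StochGame K A B) {N : ℕ} (p : K → ℝ)
    (σ : InformedStrategy K A B N) (τ : UninformedStrategy A B N)
    (κ : Fin N → K) (a : Fin N → A) (b : Fin N → B) : ℝ :=
  ∏ t : Fin N,
    G.stateProb p κ a t
      * (σ t (Fin.take (t + 1) t.isLt κ) (Fin.take t t.isLt.le a) (Fin.take t t.isLt.le b)).1 (a t)
      * (τ t (Fin.take t t.isLt.le a) (Fin.take t t.isLt.le b)).1 (b t)

/-- Expectation of a function of the play. -/
noncomputable def expect (G : StochGame K A B) {N : ℕ} (p : K → ℝ)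
    (σ : InformedStrategy K A B N) (τ : UninformedStrategy A B N)
    (f : (Fin N → K) → (Fin N → A) → (Fin N → B) → ℝ) : ℝ :=
  ∑ κ : Fin N → K, ∑ a : Fin N → A, ∑ b : Fin N → B, G.playProb p σ τ κ a b * f κ a b

/-- The payoff function of the `N`-stage primal game with initial distribution `p`. -/
noncomputable def primalPayoff (G : StochGame K A B) (N : ℕ) (p : stdSimplex ℝ K)
    (σ : InformedStrategy K A B N) (τ : UninformedStrategy A B N) : ℝ :=
  G.expect p.1 σ τ (fun κ a b => ∑ t, G.M (κ t) (a t) (b t))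

/-- The payoff function of the `N`-stage dual game with initial vector payoff `α`: player 1 also
chooses the distribution of the initial state, and receives in addition `α k₁`. -/
noncomputable def dualPayoff (G : StochGame K A B) (N : ℕ) [NeZero N] (α : K → ℝ)
    (s : stdSimplex ℝ K × InformedStrategy K A B N) (τ : UninformedStrategy A B N) : ℝ :=
  G.expect s.1.1 s.2 τ (fun κ a b => α (κ 0) + ∑ t, G.M (κ t) (a t) (b t))

/-- The value `w_N(α)` of the `N`-stage dual game, as its minmax value. -/
noncomputable def dualValue (G : StochGame K A B) (N : ℕ) [NeZero N] (α : K → ℝ) : ℝ :=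
  upperValue (G.dualPayoff N α)

/-! ### Regret -/

/-- `α` is a regret at stage 1 of the `N`-stage primal game with initial distribution `p`: it
minimizes `w_N(α) - pᵀ α` over all vectors `α`. -/
def IsInitialRegret (G : StochGame K A B) (N : ℕ) [NeZero N] (p : stdSimplex ℝ K)
    (α : K → ℝ) : Prop :=
  ∀ α' : K → ℝ, G.dualValue N α - ∑ k, p.1 k * α k ≤ G.dualValue N α' - ∑ k, p.1 k * α' k

/-- `max_{Π ∈ Δ(K × A)} ∑_{k,a} Π(k,a) (M_k(a,:) ŷ + α(k) - Q_a(k,:) β_a + w_n(β_a))`. -/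
noncomputable def updateObjective (G : StochGame K A B) (n : ℕ) [NeZero n] (α : K → ℝ)
    (yhat : B → ℝ) (β : A → K → ℝ) : ℝ :=
  ⨆ P : stdSimplex ℝ (K × A), ∑ k, ∑ a, P.1 (k, a) *
    ((∑ b, G.M k a b * yhat b) + α k - (∑ k', G.Q a k k' * β a k') + G.dualValue n (β a))

/-- `(yhat, β)` solves the minmax problem which updates the regret `α` when `n` stages remain after
the current one; `β a` is then the regret at the next stage after player 1's action `a`. -/
def IsRegretUpdate (G : StochGame K A B) (n : ℕ) [NeZero n] (α : K → ℝ)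
    (yhat : B → ℝ) (β : A → K → ℝ) : Prop :=
  yhat ∈ stdSimplex ℝ B ∧
    ∀ yhat' ∈ stdSimplex ℝ B, ∀ β' : A → K → ℝ,
      G.updateObjective n α yhat β ≤ G.updateObjective n α yhat' β'

end StochGame

/-! ### Linear programs -/

/-- A linear program in real variables indexed by `V`, with inequality constraints indexed by `I`
and equality constraints indexed by `E`: minimize `objective x` subject to
`ineq i x ≤ ineqRhs i` and `eqn e x = eqnRhs e`. -/
structure LinearProgram (V I E : Type*) where
  objective : (V → ℝ) →ₗ[ℝ] ℝ
  ineq : I → ((V → ℝ) →ₗ[ℝ] ℝ)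
  ineqRhs : I → ℝ
  eqn : E → ((V → ℝ) →ₗ[ℝ] ℝ)
  eqnRhs : E → ℝ

namespace LinearProgram

variable {V I E : Type*}

/-- The set of feasible points. -/
def feasible (P : LinearProgram V I E) : Set (V → ℝ) :=
  {x | (∀ i, P.ineq i x ≤ P.ineqRhs i) ∧ ∀ e, P.eqn e x = P.eqnRhs e}

/-- `x` is an optimal solution. -/
def IsOptimal (P : LinearProgram V I E) (x : V → ℝ) : Prop :=
  x ∈ P.feasible ∧ ∀ x' ∈ P.feasible, P.objective x ≤ P.objective x'

end LinearProgram

/-! ### The regret linear program with `n = m + 1` stages after the current one -/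

/-- Variables: `ŷ(b)`, `β_a(k)`, `ℓ̃`, `ℓ̂_a`, `y_{a,I_t}(b)` with `I_t ∈ A^{t-1}`, and
`ℓ_{a,F_t}` with `F_t ∈ K^t × A^{t-1}`, for `t = 1, …, m + 1` (here `t` is counted from `0`). -/
inductive RegretVar (K A B : Type*) (m : ℕ)
  | yhat (b : B)
  | beta (a : A) (k : K)
  | ltilde
  | lhat (a : A)
  | y (a : A) (t : Fin (m + 1)) (h : Fin t → A) (b : B)
  | ell (a : A) (t : Fin (m + 1)) (κ : Fin (t + 1) → K) (h : Fin t → A)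

/-- Inequality constraints, including the nonnegativity of the probability vectors. A constraint
`flow a t κ h` belongs to the pair consisting of `F = (κ, h without its last entry)` and of the last
action in `h`. -/
inductive RegretIneq (K A B : Type*) (m : ℕ)
  | current (a : A) (k : K)
  | initial (a : A) (k : K)
  | flow (a : A) (t : Fin m) (κ : Fin (t + 1) → K) (h : Fin (t + 1) → A)
  | terminal (a : A) (κ : Fin (m + 1) → K) (h : Fin (m + 1) → A)
  | yhat_nonneg (b : B)
  | y_nonneg (a : A) (t : Fin (m + 1)) (h : Fin t → A) (b : B)

/-- Equality constraints: the probability vectors sum to one. -/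
inductive RegretEqn (A : Type*) (m : ℕ)
  | yhat_sum
  | y_sum (a : A) (t : Fin (m + 1)) (h : Fin t → A)

/-- The linear program for the regret `α` with `n = m + 1` stages after the current one. In the code
`v i` is the coordinate `x ↦ x i`. The constraints read
* `current`: `M_k(a,:) ŷ + α(k) - Q_a(k,:) β_a + ℓ̂_a ≤ ℓ̃`;
* `initial`: `β_a(k) + ℓ_{a,F_1} ≤ ℓ̂_a` with `F_1 = (k)`;
* `flow`: `∑_{k'} ℓ_{a,(F,(k',a'))} ≤ ℓ_{a,F}`;
* `terminal`: `∏_{t=1}^{n-1} Q_{a_t}(k_t,k_{t+1}) ∑_{t=1}^n M_{k_t}(a_t,:) y_{a,I_t} ≤ ℓ_{a,F_n}`. -/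
noncomputable def StochGame.regretLP {K A B : Type*} [Fintype K] [Fintype B]
    (G : StochGame K A B) (m : ℕ) (α : K → ℝ) :
    LinearProgram (RegretVar K A B m) (RegretIneq K A B m) (RegretEqn A m) :=
  let v : RegretVar K A B m → ((RegretVar K A B m → ℝ) →ₗ[ℝ] ℝ) := fun i => LinearMap.proj i
  { objective := v .ltilde
    ineq := fun c => match c with
      | .current a k =>
          (∑ b, G.M k a b • v (.yhat b)) - (∑ k', G.Q a k k' • v (.beta a k'))
            + v (.lhat a) - v .ltilde
      | .initial a k => v (.beta a k) + v (.ell a 0 (fun _ => k) Fin.elim0) - v (.lhat a)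
      | .flow a t κ h =>
          (∑ k', v (.ell a ⟨t + 1, Nat.succ_lt_succ t.isLt⟩ (Fin.snoc κ k') h))
            - v (.ell a ⟨t, t.isLt.trans (Nat.lt_succ_self m)⟩ κ
                (Fin.take t (Nat.le_succ _) h))
      | .terminal a κ h =>
          (∏ s : Fin m, G.Q (h s.castSucc) (κ s.castSucc) (κ s.succ)) •
              (∑ t : Fin (m + 1), ∑ b,
                G.M (κ t) (h t) b • v (.y a t (Fin.take t t.isLt.le h) b))
            - v (.ell a ⟨m, Nat.lt_succ_self m⟩ κ (Fin.take m (Nat.le_succ m) h))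
      | .yhat_nonneg b => - v (.yhat b)
      | .y_nonneg a t h b => - v (.y a t h b)
    ineqRhs := fun c => match c with
      | .current _ k => - α k
      | _ => 0
    eqn := fun e => match e with
      | .yhat_sum => ∑ b, v (.yhat b)
      | .y_sum a t h => ∑ b, v (.y a t h b)
    eqnRhs := fun _ => 1 }

/-! ### Decomposition of sums and of plays at the first stage -/

/-! Player 2 never needs to recall his own actions: transitions do not depend on them, so against a
player 1 who ignores them a behavior strategy of player 2 can be averaged into a plan `Y`
(`exists_isMixed_totalPayoff_eq`), and the payoff is linear in `Y`. Against a plan, dynamic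
programming gives player 1's best payoff `bestPayoff Y k` from each initial state, and observing
player 2 does not improve it. In the dual game player 1 chooses the initial state, so `Y` guarantees
exactly `max_k (α k + bestPayoff Y k)`. Sion's theorem gives a saddle point, hence the value and an
optimal plan (`exists_isMixed_hasValue`).

The linear program unfolds this recursion. Each `ℓ` bounds the probability weight of a history times
the sum of past and best future payoffs; the weights are carried inside `ℓ`, which is why the sums
over the next state bear no coefficients (`IsFlowBound.bestPayoff_le`, `exists_isFlowBound`). A
feasible point thus satisfies `β_a + bestPayoff Y_a ≤ ℓ̂_a`; averaging this with the weights
`Q_a(k,·)` cancels `β_a`, and `ŷ` followed by `Y_a` guarantees `ℓ̃`. Conversely an optimal plan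
yields a feasible point with `β_a = -bestPayoff Y_a` and `ℓ̂_a = 0`. So the optimum is the dual
value, and optimal points carry security strategies. Since `ℓ̂_a` bounds the dual value at `β_a`,
they also solve the update problem.

For the primal game, comparing the regret with the vector `-bestPayoff Y` shows that `w(α) - pᵀα`
does not exceed the primal minmax value, so a dual security strategy is a primal one
(`dualValue_sub_le_primalPayoff`). -/

theorem Fin.sum_pi_succ {X : Type*} [Fintype X] {n : ℕ} (f : (Fin (n + 1) → X) → ℝ) :
    ∑ κ, f κ = ∑ x, ∑ κ : Fin n → X, f (Fin.cons x κ) := by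
  rw [← Fintype.sum_prod_type', ← (Fin.consEquiv (fun _ : Fin (n + 1) => X)).sum_comp]
  rfl

theorem Fin.take_succ_cons {X : Type*} {n : ℕ} (m : ℕ) (h : m + 1 ≤ n + 1) (x : X)
    (κ : Fin n → X) :
    Fin.take (m + 1) h (Fin.cons x κ : Fin (n + 1) → X) =
      Fin.cons x (Fin.take m (Nat.le_of_succ_le_succ h) κ) := by
  ext i
  refine Fin.cases ?_ (fun j => ?_) i <;> rfl

/-- The strategy of player 1 after the first stage. -/
def InformedStrategy.shift {K A B : Type*} [Fintype A] {n : ℕ}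
    (σ : InformedStrategy K A B (n + 1)) (k : K) (a : A) (b : B) : InformedStrategy K A B n :=
  fun t κ h j => σ t.succ (Fin.cons k κ) (Fin.cons a h) (Fin.cons b j)

/-- The strategy of player 2 after the first stage. -/
def UninformedStrategy.shift {A B : Type*} [Fintype B] {n : ℕ}
    (τ : UninformedStrategy A B (n + 1)) (a : A) (b : B) : UninformedStrategy A B n :=
  fun t h j => τ t.succ (Fin.cons a h) (Fin.cons b j)

/-- The first mixed action of player 1 in state `k`. -/
def InformedStrategy.first {K A B : Type*} [Fintype A] {n : ℕ}
    (σ : InformedStrategy K A B (n + 1)) (k : K) : stdSimplex ℝ A :=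
  σ 0 (fun _ => k) Fin.elim0 Fin.elim0

/-- The first mixed action of player 2. -/
def UninformedStrategy.first {A B : Type*} [Fintype B] {n : ℕ}
    (τ : UninformedStrategy A B (n + 1)) : stdSimplex ℝ B :=
  τ 0 Fin.elim0 Fin.elim0

namespace StochGame

variable {K A B : Type*} [Fintype K]

theorem stateProb_cons_succ (G : StochGame K A B) {n : ℕ} (p : K → ℝ) (k : K) (a : A)
    (κ : Fin n → K) (h : Fin n → A) (t : Fin n) :
    G.stateProb p (Fin.cons k κ : Fin (n + 1) → K) (Fin.cons a h : Fin (n + 1) → A) t.succ =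
      G.stateProb (G.Q a k) κ h t := by
  obtain ⟨t, ht⟩ := t
  cases t with
  | zero => rfl
  | succ t => rfl

variable [Fintype A] [Fintype B]

theorem playProb_cons (G : StochGame K A B) {n : ℕ} (p : K → ℝ)
    (σ : InformedStrategy K A B (n + 1)) (τ : UninformedStrategy A B (n + 1))
    (k : K) (κ : Fin n → K) (a : A) (h : Fin n → A) (b : B) (j : Fin n → B) :
    G.playProb p σ τ (Fin.cons k κ) (Fin.cons a h) (Fin.cons b j) =
      p k * (σ.first k).1 a * τ.first.1 b *
        G.playProb (G.Q a k) (σ.shift k a b) (τ.shift a b) κ h j := by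
  unfold playProb
  rw [Fin.prod_univ_succ]
  congr 1
  · have h1 : Fin.take (((0 : Fin (n + 1)) : ℕ) + 1) (0 : Fin (n + 1)).isLt
        (Fin.cons k κ : Fin (n + 1) → K) = fun _ => k := by
      ext i
      obtain ⟨i, hi⟩ := i
      obtain rfl : i = 0 := by simpa using hi
      rfl
    have h2 : Fin.take ((0 : Fin (n + 1)) : ℕ) (0 : Fin (n + 1)).isLt.le
        (Fin.cons a h : Fin (n + 1) → A) = Fin.elim0 := funext fun i => i.elim0
    have h3 : Fin.take ((0 : Fin (n + 1)) : ℕ) (0 : Fin (n + 1)).isLt.le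
        (Fin.cons b j : Fin (n + 1) → B) = Fin.elim0 := funext fun i => i.elim0
    rw [h1, h2, h3]
    rfl
  · refine Finset.prod_congr rfl fun t _ => ?_
    rw [stateProb_cons_succ]
    have h1 : Fin.take ((t.succ : ℕ) + 1) t.succ.isLt (Fin.cons k κ : Fin (n + 1) → K) =
        (Fin.cons k (Fin.take (t + 1) t.isLt κ) : Fin (t + 1 + 1) → K) :=
      Fin.take_succ_cons _ _ _ _
    have h2 : Fin.take (t.succ : ℕ) t.succ.isLt.le (Fin.cons a h : Fin (n + 1) → A) =
        (Fin.cons a (Fin.take t t.isLt.le h) : Fin (t + 1) → A) :=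
      Fin.take_succ_cons _ _ _ _
    have h3 : Fin.take (t.succ : ℕ) t.succ.isLt.le (Fin.cons b j : Fin (n + 1) → B) =
        (Fin.cons b (Fin.take t t.isLt.le j) : Fin (t + 1) → B) :=
      Fin.take_succ_cons _ _ _ _
    rw [h1, h2, h3]
    rfl

/-- After the first stage the play is again a play of the same game, with initial law `Q a k` and
shifted strategies. All later inductions on the number of stages rest on this. -/
theorem expect_succ (G : StochGame K A B) {n : ℕ} (p : K → ℝ)
    (σ : InformedStrategy K A B (n + 1)) (τ : UninformedStrategy A B (n + 1))
    (f : (Fin (n + 1) → K) → (Fin (n + 1) → A) → (Fin (n + 1) → B) → ℝ) :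
    G.expect p σ τ f = ∑ k, p k * ∑ a, (σ.first k).1 a * ∑ b, τ.first.1 b *
      G.expect (G.Q a k) (σ.shift k a b) (τ.shift a b)
        (fun κ h j => f (Fin.cons k κ) (Fin.cons a h) (Fin.cons b j)) := by
  unfold expect
  rw [Fin.sum_pi_succ]
  refine Finset.sum_congr rfl fun k _ => ?_
  simp_rw [Fin.sum_pi_succ (X := A), Fin.sum_pi_succ (X := B)]
  rw [Finset.sum_comm, Finset.mul_sum]
  refine Finset.sum_congr rfl fun a _ => ?_
  simp_rw [Finset.mul_sum]
  calc _ = ∑ κ, ∑ b, ∑ h, ∑ j, G.playProb p σ τ (Fin.cons k κ) (Fin.cons a h) (Fin.cons b j)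
        * f (Fin.cons k κ) (Fin.cons a h) (Fin.cons b j) :=
        Finset.sum_congr rfl fun κ _ => Finset.sum_comm
    _ = _ := by
      rw [Finset.sum_comm]
      refine Finset.sum_congr rfl fun b _ => Finset.sum_congr rfl fun κ _ =>
        Finset.sum_congr rfl fun h _ => Finset.sum_congr rfl fun j _ => ?_
      rw [playProb_cons]
      ring

theorem expect_add (G : StochGame K A B) {n : ℕ} (p : K → ℝ)
    (σ : InformedStrategy K A B n) (τ : UninformedStrategy A B n)
    (f g : (Fin n → K) → (Fin n → A) → (Fin n → B) → ℝ) :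
    G.expect p σ τ (fun κ h j => f κ h j + g κ h j) = G.expect p σ τ f + G.expect p σ τ g := by
  simp only [expect, mul_add, Finset.sum_add_distrib]

theorem expect_const (G : StochGame K A B) {n : ℕ} {p : K → ℝ} (hp : ∑ k, p k = 1)
    (σ : InformedStrategy K A B n) (τ : UninformedStrategy A B n) (c : ℝ) :
    G.expect p σ τ (fun _ _ _ => c) = c := by
  induction n generalizing p with
  | zero => simp [expect, playProb]
  | succ n ih =>
    rw [expect_succ]
    simp_rw [ih (G.Q_mem _ _).2, ← Finset.sum_mul, (τ.first).2.2, (σ.first _).2.2]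
    simp only [← Finset.sum_mul, hp, one_mul]

/-- The expected total payoff. -/
noncomputable def totalPayoff (G : StochGame K A B) {n : ℕ} (p : K → ℝ)
    (σ : InformedStrategy K A B n) (τ : UninformedStrategy A B n) : ℝ :=
  G.expect p σ τ (fun κ h j => ∑ t, G.M (κ t) (h t) (j t))

theorem totalPayoff_zero (G : StochGame K A B) (p : K → ℝ)
    (σ : InformedStrategy K A B 0) (τ : UninformedStrategy A B 0) : G.totalPayoff p σ τ = 0 := by
  simp [totalPayoff, expect]

theorem totalPayoff_succ (G : StochGame K A B) {n : ℕ} (p : K → ℝ)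
    (σ : InformedStrategy K A B (n + 1)) (τ : UninformedStrategy A B (n + 1)) :
    G.totalPayoff p σ τ = ∑ k, p k * ∑ a, (σ.first k).1 a * ∑ b, τ.first.1 b *
      (G.M k a b + G.totalPayoff (G.Q a k) (σ.shift k a b) (τ.shift a b)) := by
  rw [totalPayoff, expect_succ]
  simp_rw [Fin.sum_univ_succ, Fin.cons_zero, Fin.cons_succ, expect_add,
    expect_const G (G.Q_mem _ _).2]
  rfl

theorem dualPayoff_eq (G : StochGame K A B) (n : ℕ) (α : K → ℝ)
    (s : stdSimplex ℝ K × InformedStrategy K A B (n + 1)) (τ : UninformedStrategy A B (n + 1)) :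
    G.dualPayoff (n + 1) α s τ = ∑ k, s.1.1 k * α k + G.totalPayoff s.1.1 s.2 τ := by
  rw [dualPayoff, expect_add]
  congr 1
  rw [expect_succ]
  simp_rw [Fin.cons_zero, expect_const G (G.Q_mem _ _).2, ← Finset.sum_mul, (τ.first).2.2,
    (s.2.first _).2.2, one_mul]

theorem primalPayoff_eq (G : StochGame K A B) (n : ℕ) (p : stdSimplex ℝ K)
    (σ : InformedStrategy K A B n) (τ : UninformedStrategy A B n) :
    G.primalPayoff n p σ τ = G.totalPayoff p.1 σ τ := rfl

end StochGame

/-! ### Strategies that ignore the actions of player 2 -/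

/-- Behavior strategies of player 1 that ignore the actions of player 2. -/
abbrev BlindStrategy (K A : Type*) [Fintype A] (n : ℕ) : Type _ :=
  (t : Fin n) → (Fin (t + 1) → K) → (Fin t → A) → stdSimplex ℝ A

/-- Vectors indexed by stages, past actions of player 1 and actions of player 2. Those with mixed
actions as entries are the behavior strategies of player 2 that ignore his own actions. -/
abbrev Plan (A B : Type*) (n : ℕ) : Type _ := (t : Fin n) → (Fin t → A) → B → ℝ

namespace BlindStrategy

variable {K A : Type*} [Fintype A] {n : ℕ}

/-- A blind strategy as a behavior strategy. -/
def toInformed (B : Type*) (σ : BlindStrategy K A n) : InformedStrategy K A B n :=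
  fun t κ h _ => σ t κ h

/-- The first mixed action in state `k`. -/
def first (σ : BlindStrategy K A (n + 1)) (k : K) : stdSimplex ℝ A := σ 0 (fun _ => k) Fin.elim0

/-- The strategy after the first stage. -/
def shift (σ : BlindStrategy K A (n + 1)) (k : K) (a : A) : BlindStrategy K A n :=
  fun t κ h => σ t.succ (Fin.cons k κ) (Fin.cons a h)

/-- The strategy that starts with `x` and continues with `σ`. -/
def cons (x : K → stdSimplex ℝ A) (σ : K → A → BlindStrategy K A n) :
    BlindStrategy K A (n + 1) :=
  fun t => Fin.cases
    (motive := fun t : Fin (n + 1) => (Fin (t + 1) → K) → (Fin t → A) → stdSimplex ℝ A)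
    (fun κ _ => x (κ 0))
    (fun t κ h => σ (κ 0) (h ⟨0, Nat.succ_pos t⟩) t (fun i => κ i.succ) (fun i => h i.succ)) t

theorem first_cons (x : K → stdSimplex ℝ A) (σ : K → A → BlindStrategy K A n) (k : K) :
    (cons x σ).first k = x k := rfl

theorem shift_cons (x : K → stdSimplex ℝ A) (σ : K → A → BlindStrategy K A n) (k : K) (a : A) :
    (cons x σ).shift k a = σ k a := rfl

end BlindStrategy

namespace Plan

variable {A B : Type*} {n : ℕ}

/-- The first entry. -/
def first : Plan A B (n + 1) →ₗ[ℝ] (B → ℝ) where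
  toFun Y := Y 0 Fin.elim0
  map_add' _ _ := rfl
  map_smul' _ _ := rfl

/-- The plan after the first stage. -/
def shift (a : A) : Plan A B (n + 1) →ₗ[ℝ] Plan A B n where
  toFun Y t h := Y t.succ (Fin.cons a h)
  map_add' _ _ := rfl
  map_smul' _ _ := rfl

/-- The plan that starts with `y` and continues with `Y`. -/
def cons (y : B → ℝ) (Y : A → Plan A B n) : Plan A B (n + 1) :=
  fun t => Fin.cases (motive := fun t : Fin (n + 1) => (Fin t → A) → B → ℝ)
    (fun _ => y) (fun t h => Y (h ⟨0, Nat.succ_pos t⟩) t (fun i => h i.succ)) t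

theorem first_cons (y : B → ℝ) (Y : A → Plan A B n) : first (cons y Y) = y := rfl

theorem shift_cons (y : B → ℝ) (Y : A → Plan A B n) (a : A) : shift a (cons y Y) = Y a := rfl

variable [Fintype B]

/-- All entries are mixed actions. -/
def IsMixed (Y : Plan A B n) : Prop := ∀ t h, Y t h ∈ stdSimplex ℝ B

theorem IsMixed.first {Y : Plan A B (n + 1)} (hY : Y.IsMixed) : Plan.first Y ∈ stdSimplex ℝ B :=
  hY _ _

theorem IsMixed.shift {Y : Plan A B (n + 1)} (hY : Y.IsMixed) (a : A) : (Plan.shift a Y).IsMixed :=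
  fun _ _ => hY _ _

theorem IsMixed.cons {y : B → ℝ} (hy : y ∈ stdSimplex ℝ B) {Y : A → Plan A B n}
    (hY : ∀ a, (Y a).IsMixed) : (Plan.cons y Y).IsMixed :=
  Fin.cases (fun _ => hy) (fun t _ => hY _ t _)

/-- The behavior strategy given by a mixed plan. -/
def IsMixed.toStrategy {Y : Plan A B n} (hY : Y.IsMixed) : UninformedStrategy A B n :=
  fun t h _ => ⟨Y t h, hY t h⟩

theorem convex_isMixed (n : ℕ) : Convex ℝ {Y : Plan A B n | Y.IsMixed} :=
  fun _ hY _ hY' _ _ ha hb hab t h => convex_stdSimplex ℝ B (hY t h) (hY' t h) ha hb hab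

theorem isCompact_isMixed (n : ℕ) : IsCompact {Y : Plan A B n | Y.IsMixed} := by
  have h : {Y : Plan A B n | Y.IsMixed} =
      Set.univ.pi fun _ => Set.univ.pi fun _ => stdSimplex ℝ B := by
    ext Y; simp [Plan.IsMixed]
  rw [h]
  exact isCompact_univ_pi fun _ => isCompact_univ_pi fun _ => isCompact_stdSimplex ℝ B

end Plan

/-! ### Payoffs of blind strategies against plans -/

namespace StochGame

variable {K A B : Type*} [Fintype K] [Fintype A] [Fintype B]

/-- The expected payoff when the initial state is `k` and nobody observes player 2's actions. -/
noncomputable def blindPayoff (G : StochGame K A B) :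
    (n : ℕ) → K → BlindStrategy K A n → (Plan A B n →ₗ[ℝ] ℝ)
  | 0, _, _ => 0
  | n + 1, k, σ => ∑ a, (σ.first k).1 a •
      ((∑ b, G.M k a b • (LinearMap.proj b ∘ₗ Plan.first)) +
        ∑ k', G.Q a k k' • (G.blindPayoff n k' (σ.shift k a) ∘ₗ Plan.shift a))

theorem blindPayoff_succ (G : StochGame K A B) {n : ℕ} (k : K) (σ : BlindStrategy K A (n + 1))
    (Y : Plan A B (n + 1)) :
    G.blindPayoff (n + 1) k σ Y = ∑ a, (σ.first k).1 a * ((∑ b, G.M k a b * Y.first b) +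
      ∑ k', G.Q a k k' * G.blindPayoff n k' (σ.shift k a) (Y.shift a)) := by
  simp [blindPayoff, mul_add]

/-- A blind player 1 cannot distinguish player 2's actions and the states do not depend on them.
Hence the continuation plans may be averaged over `b` with the weights of the first mixed action;
linearity of `blindPayoff` in the plan preserves the payoff, for all `p` and `σ` at once. -/
theorem exists_isMixed_totalPayoff_eq (G : StochGame K A B) {n : ℕ}
    (τ : UninformedStrategy A B n) :
    ∃ Y : Plan A B n, Y.IsMixed ∧ ∀ (p : K → ℝ) (σ : BlindStrategy K A n),
      G.totalPayoff p (σ.toInformed B) τ = ∑ k, p k * G.blindPayoff n k σ Y := by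
  induction n with
  | zero => exact ⟨0, fun t => t.elim0, fun p σ => by simp [totalPayoff_zero, blindPayoff]⟩
  | succ n ih =>
    choose Y hY hpay using fun a b => ih (τ.shift a b)
    refine ⟨Plan.cons τ.first.1 fun a => ∑ b, τ.first.1 b • Y a b,
      Plan.IsMixed.cons τ.first.2 fun a t h => ?_, fun p σ => ?_⟩
    · rw [Finset.sum_apply, Finset.sum_apply]
      exact (convex_stdSimplex ℝ B).sum_mem (fun b _ => τ.first.2.1 b) τ.first.2.2
        fun b _ => hY a b t h
    · rw [totalPayoff_succ]
      refine Finset.sum_congr rfl fun k _ => ?_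
      rw [blindPayoff_succ]
      congr 1
      refine Finset.sum_congr rfl fun a _ => ?_
      congr 1
      have h (b : B) : G.totalPayoff (G.Q a k) ((σ.toInformed B).shift k a b) (τ.shift a b) = _ :=
        hpay a b (G.Q a k) (σ.shift k a)
      simp_rw [h, mul_add, Finset.sum_add_distrib, Plan.first_cons, Plan.shift_cons, map_sum,
        map_smul, Finset.mul_sum, smul_eq_mul]
      congr 1
      · exact Finset.sum_congr rfl fun b _ => mul_comm _ _
      · rw [Finset.sum_comm]
        exact Finset.sum_congr rfl fun k' _ => Finset.sum_congr rfl fun b _ => mul_left_comm _ _ _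

/-! ### Best responses of player 1 -/

/-- The best payoff of player 1 from the initial state `k` against a plan. -/
noncomputable def bestPayoff (G : StochGame K A B) : (n : ℕ) → Plan A B n → K → ℝ
  | 0, _, _ => 0
  | n + 1, Y, k => ⨆ a, ((∑ b, G.M k a b * Y.first b) +
      ∑ k', G.Q a k k' * G.bestPayoff n (Y.shift a) k')

theorem le_bestPayoff_succ (G : StochGame K A B) {n : ℕ} (Y : Plan A B (n + 1)) (k : K) (a : A) :
    (∑ b, G.M k a b * Y.first b) + ∑ k', G.Q a k k' * G.bestPayoff n (Y.shift a) k' ≤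
      G.bestPayoff (n + 1) Y k :=
  le_ciSup (f := fun a => (∑ b, G.M k a b * Y.first b) +
    ∑ k', G.Q a k k' * G.bestPayoff n (Y.shift a) k') (Set.finite_range _).bddAbove a

/-- The continuation of a plan does not depend on `b`, so neither does the inductive bound on the
continuation payoff: observing player 2 brings nothing. -/
theorem totalPayoff_le_bestPayoff (G : StochGame K A B) {n : ℕ} {p : K → ℝ} (hp : ∀ k, 0 ≤ p k)
    (σ : InformedStrategy K A B n) {Y : Plan A B n} (hY : Y.IsMixed) :
    G.totalPayoff p σ hY.toStrategy ≤ ∑ k, p k * G.bestPayoff n Y k := by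
  induction n generalizing p with
  | zero => simp [totalPayoff_zero, bestPayoff]
  | succ n ih =>
    rw [totalPayoff_succ]
    refine Finset.sum_le_sum fun k _ => mul_le_mul_of_nonneg_left ?_ (hp k)
    calc _ ≤ ∑ a, (σ.first k).1 a * G.bestPayoff (n + 1) Y k := by
          refine Finset.sum_le_sum fun a _ => mul_le_mul_of_nonneg_left ?_ ((σ.first k).2.1 a)
          calc _ ≤ ∑ b, Y.first b * (G.M k a b +
                ∑ k', G.Q a k k' * G.bestPayoff n (Y.shift a) k') :=
                Finset.sum_le_sum fun b _ => mul_le_mul_of_nonneg_left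
                  (add_le_add_right (ih (G.Q_mem a k).1 (σ.shift k a b) (hY.shift a)) _)
                  (hY.first.1 b)
            _ = (∑ b, G.M k a b * Y.first b) +
                ∑ k', G.Q a k k' * G.bestPayoff n (Y.shift a) k' := by
                simp_rw [mul_add, Finset.sum_add_distrib, ← Finset.sum_mul, hY.first.2, one_mul,
                  mul_comm]
            _ ≤ _ := G.le_bestPayoff_succ Y k a
      _ = _ := by rw [← Finset.sum_mul, (σ.first k).2.2, one_mul]

theorem exists_blindPayoff_eq_bestPayoff [Nonempty A] (G : StochGame K A B) {n : ℕ}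
    (Y : Plan A B n) :
    ∃ σ : BlindStrategy K A n, ∀ k, G.blindPayoff n k σ Y = G.bestPayoff n Y k := by
  classical
  induction n with
  | zero => exact ⟨fun t => t.elim0, fun k => by simp [blindPayoff, bestPayoff]⟩
  | succ n ih =>
    -- The continuation depends on `a` alone, because the inductive strategy is optimal from every
    -- next state simultaneously.
    choose σ hσ using fun a => ih (Y.shift a)
    choose a ha using fun k => exists_eq_ciSup_of_finite (f := fun a =>
      (∑ b, G.M k a b * Y.first b) + ∑ k', G.Q a k k' * G.bestPayoff n (Y.shift a) k')
    refine ⟨BlindStrategy.cons (fun k => ⟨Pi.single (a k) 1, single_mem_stdSimplex ℝ _⟩)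
      fun _ => σ, fun k => ?_⟩
    rw [blindPayoff_succ, Finset.sum_eq_single (a k)]
    · simp_rw [BlindStrategy.first_cons, BlindStrategy.shift_cons, Pi.single_eq_same, one_mul, hσ]
      exact ha k
    · intro a' _ h
      simp [BlindStrategy.first_cons, h]
    · simp

end StochGame

/-! ### Existence of the value -/

theorem sum_mul_le_of_mem_stdSimplex {ι : Type*} [Fintype ι] {p : ι → ℝ}
    (hp : p ∈ stdSimplex ℝ ι) {f : ι → ℝ} {c : ℝ} (hf : ∀ i, f i ≤ c) : ∑ i, p i * f i ≤ c :=
  calc _ ≤ ∑ i, p i * c := Finset.sum_le_sum fun i _ => mul_le_mul_of_nonneg_left (hf i) (hp.1 i)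
    _ = c := by rw [← Finset.sum_mul, hp.2, one_mul]

/-- Boundedness is required because the real supremum of an unbounded family is `0` by convention.
-/
theorem HasValue.upperValue_eq {S T : Type*} {g : S → T → ℝ} {v : ℝ} (h : HasValue g v)
    (hg : ∀ t, BddAbove (Set.range fun s => g s t)) : upperValue g = v := by
  obtain ⟨⟨s, hs⟩, t, ht⟩ := h
  have hle (t' : T) : v ≤ ⨆ s, g s t' := (hs t').trans (le_ciSup (hg t') s)
  have : Nonempty S := ⟨s⟩
  have : Nonempty T := ⟨t⟩
  refine le_antisymm ?_ (le_ciInf hle)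
  exact (ciInf_le ⟨v, by rintro _ ⟨t', rfl⟩; exact hle t'⟩ t).trans (ciSup_le ht)

namespace StochGame

variable {K A B : Type*} [Fintype K] [Fintype A] [Fintype B]

theorem exists_totalPayoff_le (G : StochGame K A B) (n : ℕ) :
    ∃ C, ∀ (p : stdSimplex ℝ K) (σ : InformedStrategy K A B n) (τ : UninformedStrategy A B n),
      G.totalPayoff p.1 σ τ ≤ C := by
  induction n with
  | zero => exact ⟨0, fun p σ τ => (G.totalPayoff_zero p.1 σ τ).le⟩
  | succ n ih =>
    obtain ⟨C, hC⟩ := ih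
    obtain ⟨D, hD⟩ := (Set.finite_range fun x : K × A × B => G.M x.1 x.2.1 x.2.2).bddAbove
    refine ⟨D + C, fun p σ τ => ?_⟩
    rw [totalPayoff_succ]
    exact sum_mul_le_of_mem_stdSimplex p.2 fun k =>
      sum_mul_le_of_mem_stdSimplex (σ.first k).2 fun a =>
        sum_mul_le_of_mem_stdSimplex τ.first.2 fun b =>
          add_le_add (hD ⟨(k, a, b), rfl⟩) (hC ⟨_, G.Q_mem a k⟩ _ _)

theorem bddAbove_primalPayoff (G : StochGame K A B) (n : ℕ) (p : stdSimplex ℝ K)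
    (τ : UninformedStrategy A B n) : BddAbove (Set.range fun σ => G.primalPayoff n p σ τ) := by
  obtain ⟨C, hC⟩ := G.exists_totalPayoff_le n
  exact ⟨C, by rintro _ ⟨σ, rfl⟩; exact hC p σ τ⟩

theorem bddAbove_dualPayoff (G : StochGame K A B) (n : ℕ) (α : K → ℝ)
    (τ : UninformedStrategy A B (n + 1)) :
    BddAbove (Set.range fun s => G.dualPayoff (n + 1) α s τ) := by
  obtain ⟨C, hC⟩ := G.exists_totalPayoff_le (n + 1)
  obtain ⟨D, hD⟩ := (Set.finite_range α).bddAbove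
  refine ⟨D + C, ?_⟩
  rintro _ ⟨s, rfl⟩
  dsimp only
  rw [dualPayoff_eq]
  exact add_le_add (sum_mul_le_of_mem_stdSimplex s.1.2 fun k => hD ⟨k, rfl⟩) (hC s.1 s.2 τ)

/-- Blind strategies are closed under mixing, with weights depending on the initial state. -/
theorem exists_blindPayoff_mix (G : StochGame K A B) {n : ℕ} (σ₁ σ₂ : BlindStrategy K A n)
    (l : K → ℝ) (h0 : ∀ k, 0 ≤ l k) (h1 : ∀ k, l k ≤ 1) :
    ∃ σ : BlindStrategy K A n, ∀ k Y, G.blindPayoff n k σ Y =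
      l k * G.blindPayoff n k σ₁ Y + (1 - l k) * G.blindPayoff n k σ₂ Y := by
  induction n generalizing l with
  | zero => exact ⟨σ₁, fun k Y => by simp [blindPayoff]⟩
  | succ n ih =>
    let x (k : K) : stdSimplex ℝ A := ⟨l k • (σ₁.first k).1 + (1 - l k) • (σ₂.first k).1,
      convex_stdSimplex ℝ A (σ₁.first k).2 (σ₂.first k).2 (h0 k) (sub_nonneg.2 (h1 k))
        (add_sub_cancel _ _)⟩
    have hx (k : K) (a : A) :
        (x k).1 a = l k * (σ₁.first k).1 a + (1 - l k) * (σ₂.first k).1 a := rfl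
    have hu (k : K) (a : A) : 0 ≤ l k * (σ₁.first k).1 a :=
      mul_nonneg (h0 k) ((σ₁.first k).2.1 a)
    have hv (k : K) (a : A) : 0 ≤ (1 - l k) * (σ₂.first k).1 a :=
      mul_nonneg (sub_nonneg.2 (h1 k)) ((σ₂.first k).2.1 a)
    -- As in Kuhn's theorem, the new weight is the posterior probability that `σ₁` is being played,
    -- given the state `k` and the action `a`.
    choose σ hσ using fun k a => ih (σ₁.shift k a) (σ₂.shift k a)
      (fun _ => l k * (σ₁.first k).1 a / (x k).1 a)
      (fun _ => div_nonneg (hu k a) ((x k).2.1 a))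
      (fun _ => div_le_one_of_le₀ (by rw [hx]; linarith [hv k a]) ((x k).2.1 a))
    refine ⟨BlindStrategy.cons x σ, fun k Y => ?_⟩
    simp_rw [blindPayoff_succ, BlindStrategy.first_cons, BlindStrategy.shift_cons, hσ,
      Finset.mul_sum (s := Finset.univ) (a := l k), Finset.mul_sum (s := Finset.univ) (a := 1 - l k),
      ← Finset.sum_add_distrib]
    refine Finset.sum_congr rfl fun a _ => ?_
    -- If the denominator vanishes, so do both nonnegative terms that compose it, and the default
    -- value of the quotient is harmless.
    have e1 : (x k).1 a * (l k * (σ₁.first k).1 a / (x k).1 a) = l k * (σ₁.first k).1 a := by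
      by_cases h : (x k).1 a = 0
      · have := hu k a
        have := hv k a
        rw [hx] at h
        rw [hx, h]
        linarith
      · exact mul_div_cancel₀ _ h
    have e2 : (x k).1 a * (1 - l k * (σ₁.first k).1 a / (x k).1 a) =
        (1 - l k) * (σ₂.first k).1 a := by
      rw [mul_sub, e1, hx]; ring
    have e3 : ∀ c u v : ℝ, ∀ f g q : K → ℝ, ∀ w : ℝ,
        w * (c + ∑ k', q k' * (u * f k' + v * g k')) =
          w * c + w * u * ∑ k', q k' * f k' + w * v * ∑ k', q k' * g k' := by
      intro c u v f g q w
      have : ∑ k', q k' * (u * f k' + v * g k') =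
          u * ∑ k', q k' * f k' + v * ∑ k', q k' * g k' := by
        rw [Finset.mul_sum, Finset.mul_sum, ← Finset.sum_add_distrib]
        exact Finset.sum_congr rfl fun _ _ => by ring
      rw [this]; ring
    rw [e3, e1, e2, hx]
    ring

theorem continuous_blindPayoff (G : StochGame K A B) {n : ℕ} (k : K) (Y : Plan A B n) :
    Continuous fun σ : BlindStrategy K A n => G.blindPayoff n k σ Y := by
  induction n generalizing k with
  | zero => simpa [blindPayoff] using continuous_const
  | succ n ih =>
    simp_rw [blindPayoff_succ]
    have hfirst (a : A) :
        Continuous fun σ : BlindStrategy K A (n + 1) => (σ.first k).1 a :=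
      (continuous_apply a).comp (continuous_subtype_val.comp
        ((continuous_apply _).comp ((continuous_apply _).comp (continuous_apply _))))
    have hshift (a : A) :
        Continuous fun σ : BlindStrategy K A (n + 1) => σ.shift k a :=
      continuous_pi fun t => continuous_pi fun κ => continuous_pi fun h =>
        (continuous_apply _).comp ((continuous_apply _).comp (continuous_apply _))
    exact continuous_finsetSum _ fun a _ => (hfirst a).mul (continuous_const.add
      (continuous_finsetSum _ fun k' _ =>
        continuous_const.mul ((ih k' (Y.shift a)).comp (hshift a))))

/-- The payoff function of the dual game restricted to strategies that ignore the actions of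
player 2. -/
noncomputable def blindDualPayoff (G : StochGame K A B) (n : ℕ) (α : K → ℝ)
    (s : stdSimplex ℝ K × BlindStrategy K A n) (Y : Plan A B n) : ℝ :=
  ∑ k, s.1.1 k * (α k + G.blindPayoff n k s.2 Y)

/-- The payoff is not bilinear in `(p, σ)`, but the set of payoff functions is convex: mix the two
initial laws, and in state `k` mix the strategies with the posterior weight of the first pair. -/
theorem convex_range_blindDualPayoff (G : StochGame K A B) (n : ℕ) (α : K → ℝ) :
    Convex ℝ (Set.range (G.blindDualPayoff n α)) := by
  rintro _ ⟨⟨p₁, σ₁⟩, rfl⟩ _ ⟨⟨p₂, σ₂⟩, rfl⟩ a b ha hb hab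
  let p : stdSimplex ℝ K := ⟨a • p₁.1 + b • p₂.1, convex_stdSimplex ℝ K p₁.2 p₂.2 ha hb hab⟩
  have hp (k : K) : p.1 k = a * p₁.1 k + b * p₂.1 k := rfl
  have hu (k : K) : 0 ≤ a * p₁.1 k := mul_nonneg ha (p₁.2.1 k)
  have hv (k : K) : 0 ≤ b * p₂.1 k := mul_nonneg hb (p₂.2.1 k)
  obtain ⟨σ, hσ⟩ := G.exists_blindPayoff_mix σ₁ σ₂ (fun k => a * p₁.1 k / p.1 k)
    (fun k => div_nonneg (hu k) (p.2.1 k))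
    (fun k => div_le_one_of_le₀ (by rw [hp]; linarith [hv k]) (p.2.1 k))
  refine ⟨(p, σ), funext fun Y => ?_⟩
  simp only [blindDualPayoff, Pi.add_apply, Pi.smul_apply, smul_eq_mul, Finset.mul_sum,
    ← Finset.sum_add_distrib, hσ]
  refine Finset.sum_congr rfl fun k _ => ?_
  have e1 : p.1 k * (a * p₁.1 k / p.1 k) = a * p₁.1 k := by
    by_cases h : p.1 k = 0
    · have := hu k
      have := hv k
      rw [hp] at h
      rw [hp, h]
      linarith
    · exact mul_div_cancel₀ _ h
  have e2 : p.1 k * (1 - a * p₁.1 k / p.1 k) = b * p₂.1 k := by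
    rw [mul_sub, e1, hp]; ring
  rw [mul_add, mul_add, ← mul_assoc, ← mul_assoc, e1, e2, hp]
  ring

theorem isCompact_range_blindDualPayoff (G : StochGame K A B) (n : ℕ) (α : K → ℝ) :
    IsCompact (Set.range (G.blindDualPayoff n α)) :=
  isCompact_range <| continuous_pi fun Y => continuous_finsetSum _ fun k _ =>
    ((continuous_apply k).comp (continuous_subtype_val.comp continuous_fst)).mul
      (continuous_const.add ((G.continuous_blindPayoff k Y).comp continuous_snd))

theorem blindDualPayoff_add_smul (G : StochGame K A B) (n : ℕ) (α : K → ℝ)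
    (s : stdSimplex ℝ K × BlindStrategy K A n) (Y Y' : Plan A B n) {a b : ℝ} (hab : a + b = 1) :
    G.blindDualPayoff n α s (a • Y + b • Y') =
      a * G.blindDualPayoff n α s Y + b * G.blindDualPayoff n α s Y' := by
  simp only [blindDualPayoff, map_add, map_smul, smul_eq_mul, Finset.mul_sum,
    ← Finset.sum_add_distrib]
  refine Finset.sum_congr rfl fun k _ => ?_
  linear_combination (- s.1.1 k * α k) * hab

/-- In Sion's theorem a strategy of player 1 is replaced by its payoff function of `Y`. The payoff
is then evaluation, linear in this function and affine in the plan, and both sets are convex and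
compact. -/
theorem exists_saddle [Nonempty K] [Nonempty A] [Nonempty B] (G : StochGame K A B) (n : ℕ)
    (α : K → ℝ) :
    ∃ (s : stdSimplex ℝ K × BlindStrategy K A n) (Y : Plan A B n), Y.IsMixed ∧
      ∀ s' Y', Y'.IsMixed → G.blindDualPayoff n α s' Y ≤ G.blindDualPayoff n α s Y' := by
  obtain ⟨Y, hY, _, ⟨s, rfl⟩, h⟩ := Sion.exists_isSaddlePointOn
    (X := {Y : Plan A B n | Y.IsMixed}) (Y := Set.range (G.blindDualPayoff n α))
    (f := fun Y f => f Y)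
    ⟨fun _ _ => (Classical.arbitrary (stdSimplex ℝ B)).1, fun _ _ => Subtype.prop _⟩
    (Plan.convex_isMixed n) (Plan.isCompact_isMixed n)
    (by
      rintro _ ⟨s, rfl⟩
      refine (Continuous.lowerSemicontinuous ?_).lowerSemicontinuousOn _
      exact continuous_finsetSum _ fun k _ => continuous_const.mul
        (continuous_const.add (LinearMap.continuous_of_finiteDimensional _)))
    (by
      rintro _ ⟨s, rfl⟩
      refine ConvexOn.quasiconvexOn ⟨Plan.convex_isMixed n, ?_⟩
      intro Y _ Y' _ a b _ _ hab
      exact (G.blindDualPayoff_add_smul n α s Y Y' hab).le)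
    (G.convex_range_blindDualPayoff n α) (Set.range_nonempty _)
    (G.isCompact_range_blindDualPayoff n α)
    (fun Y _ => (continuous_apply Y).upperSemicontinuous.upperSemicontinuousOn _)
    (fun Y _ => ConcaveOn.quasiconcaveOn ⟨G.convex_range_blindDualPayoff n α,
      fun f _ g _ a b _ _ _ => le_rfl⟩)
  exact ⟨s, Y, hY, fun s' Y' hY' => h Y' hY' _ ⟨s', rfl⟩⟩

theorem dualPayoff_toStrategy_le (G : StochGame K A B) (n : ℕ) (α : K → ℝ)
    {Y : Plan A B (n + 1)} (hY : Y.IsMixed) {c : ℝ}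
    (hc : ∀ k, α k + G.bestPayoff (n + 1) Y k ≤ c)
    (s : stdSimplex ℝ K × InformedStrategy K A B (n + 1)) :
    G.dualPayoff (n + 1) α s hY.toStrategy ≤ c := by
  rw [dualPayoff_eq]
  calc _ ≤ ∑ k, s.1.1 k * α k + ∑ k, s.1.1 k * G.bestPayoff (n + 1) Y k :=
        add_le_add_right (G.totalPayoff_le_bestPayoff s.1.2.1 s.2 hY) _
    _ = ∑ k, s.1.1 k * (α k + G.bestPayoff (n + 1) Y k) := by
        simp_rw [mul_add, Finset.sum_add_distrib]
    _ ≤ c := sum_mul_le_of_mem_stdSimplex s.1.2 hc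

/-- The blind saddle point is one of the full game: a blind strategy meets every `τ` as if it were a
plan, and against a plan no informed strategy beats the best blind one. -/
theorem exists_isMixed_hasValue [Nonempty K] [Nonempty A] [Nonempty B] (G : StochGame K A B)
    (n : ℕ) (α : K → ℝ) :
    HasValue (G.dualPayoff (n + 1) α) (G.dualValue (n + 1) α) ∧
      ∃ Y : Plan A B (n + 1), Y.IsMixed ∧
        ∀ k, α k + G.bestPayoff (n + 1) Y k ≤ G.dualValue (n + 1) α := by
  classical
  obtain ⟨s, Y, hY, h⟩ := G.exists_saddle (n + 1) α
  have hbest (k : K) : α k + G.bestPayoff (n + 1) Y k ≤ G.blindDualPayoff (n + 1) α s Y := by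
    obtain ⟨σ, hσ⟩ := G.exists_blindPayoff_eq_bestPayoff Y
    -- Player 1 deviates to the initial state `k` for sure and then to a best response.
    refine le_trans (le_of_eq ?_) (h (⟨Pi.single k 1, single_mem_stdSimplex ℝ k⟩, σ) Y hY)
    rw [blindDualPayoff, Finset.sum_eq_single k]
    · simp [hσ]
    · intro k' _ hk
      simp [hk]
    · simp
  have hval : HasValue (G.dualPayoff (n + 1) α) (G.blindDualPayoff (n + 1) α s Y) := by
    refine ⟨⟨(s.1, s.2.toInformed B), fun τ => ?_⟩, hY.toStrategy,
      G.dualPayoff_toStrategy_le n α hY hbest⟩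
    obtain ⟨Y', hY', hpay⟩ := G.exists_isMixed_totalPayoff_eq τ
    refine (h s Y' hY').trans (le_of_eq ?_)
    rw [dualPayoff_eq, hpay, blindDualPayoff]
    simp_rw [mul_add, Finset.sum_add_distrib]
  have hv := hval.upperValue_eq (G.bddAbove_dualPayoff n α)
  rw [dualValue, hv]
  exact ⟨hval, Y, hY, hbest⟩

theorem dualValue_le [Nonempty K] [Nonempty A] [Nonempty B] (G : StochGame K A B) {n : ℕ}
    {α : K → ℝ} {Y : Plan A B (n + 1)} (hY : Y.IsMixed) {c : ℝ}
    (hc : ∀ k, α k + G.bestPayoff (n + 1) Y k ≤ c) : G.dualValue (n + 1) α ≤ c := by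
  obtain ⟨⟨⟨s, hs⟩, -⟩, -⟩ := G.exists_isMixed_hasValue n α
  exact (hs _).trans (G.dualPayoff_toStrategy_le n α hY hc s)

end StochGame

/-! ### The linear constraints that bound the best payoff -/

theorem Fin.snoc_comp_succ {X : Type*} {n : ℕ} (κ : Fin (n + 1) → X) (x : X) :
    (fun i : Fin (n + 1) => (Fin.snoc κ x : Fin (n + 2) → X) i.succ) =
      Fin.snoc (fun i : Fin n => κ i.succ) x := by
  funext i
  refine Fin.lastCases ?_ (fun j => ?_) i
  · rw [Fin.succ_last, Fin.snoc_last, Fin.snoc_last]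
  · rw [Fin.succ_castSucc, Fin.snoc_castSucc, Fin.snoc_castSucc]

theorem Fin.snoc_const_eq_cons {X : Type*} (x y : X) :
    (Fin.snoc (fun _ : Fin 1 => x) y : Fin 2 → X) = Fin.cons x fun _ : Fin 1 => y := by
  funext i
  fin_cases i <;> rfl

namespace StochGame

variable {K A B : Type*} [Fintype K]

theorem sum_transition_mul (G : StochGame K A B) (a : A) (k : K) (w c r : ℝ) (f : K → ℝ) :
    ∑ k', w * G.Q a k k' * (c + r + f k') = w * (c + (r + ∑ k', G.Q a k k' * f k')) := by
  simp_rw [mul_add, Finset.sum_add_distrib, mul_assoc, ← Finset.mul_sum, ← Finset.sum_mul,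
    (G.Q_mem a k).2]
  ring

variable [Fintype B]

/-- The constraints `flow` and `terminal` of the linear program, for plays with initial weights `w`
and past payoff `c`. -/
structure IsFlowBound (G : StochGame K A B) (m : ℕ) (w : K → ℝ) (c : ℝ) (Y : Plan A B (m + 1))
    (ell : (t : Fin (m + 1)) → (Fin (t + 1) → K) → (Fin t → A) → ℝ) : Prop where
  flow : ∀ (t : Fin m) (κ : Fin (t + 1) → K) (h : Fin (t + 1) → A),
    ∑ k', ell ⟨t + 1, Nat.succ_lt_succ t.isLt⟩ (Fin.snoc κ k') h ≤
      ell ⟨t, t.isLt.trans (Nat.lt_succ_self m)⟩ κ (Fin.take t (Nat.le_succ _) h)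
  terminal : ∀ (κ : Fin (m + 1) → K) (h : Fin (m + 1) → A),
    w (κ 0) * (∏ s : Fin m, G.Q (h s.castSucc) (κ s.castSucc) (κ s.succ)) *
        (c + ∑ t : Fin (m + 1), ∑ b, G.M (κ t) (h t) b * Y t (Fin.take t t.isLt.le h) b) ≤
      ell ⟨m, Nat.lt_succ_self m⟩ κ (Fin.take m (Nat.le_succ m) h)

/-- The parameters `w` and `c` exist for this: the weight absorbs the transition into the new first
state, and `c` absorbs the payoff of the stage just played. -/
theorem IsFlowBound.shift {G : StochGame K A B} {m : ℕ} {w : K → ℝ} {c : ℝ}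
    {Y : Plan A B (m + 2)} {ell : (t : Fin (m + 2)) → (Fin (t + 1) → K) → (Fin t → A) → ℝ}
    (H : G.IsFlowBound (m + 1) w c Y ell) (k : K) (a : A) :
    G.IsFlowBound m (fun k' => w k * G.Q a k k') (c + ∑ b, G.M k a b * Y.first b) (Y.shift a)
      (fun t κ h => ell t.succ (Fin.cons k κ) (Fin.cons a h)) where
  flow t κ h := by
    have := H.flow t.succ (Fin.cons k κ : Fin (t + 1 + 1) → K) (Fin.cons a h : Fin (t + 1 + 1) → A)
    simp_rw [← Fin.cons_snoc_eq_snoc_cons] at this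
    have e : Fin.take (t.succ : ℕ) (Nat.le_succ _) (Fin.cons a h : Fin (t + 1 + 1) → A) =
        (Fin.cons a (Fin.take t (Nat.le_succ _) h) : Fin (t + 1) → A) :=
      Fin.take_succ_cons _ _ _ _
    rw [e] at this
    exact this
  terminal κ h := by
    have := H.terminal (Fin.cons k κ) (Fin.cons a h)
    have e : Fin.take (m + 1) (Nat.le_succ _) (Fin.cons a h : Fin (m + 1 + 1) → A) =
        (Fin.cons a (Fin.take m (Nat.le_succ _) h) : Fin (m + 1) → A) :=
      Fin.take_succ_cons _ _ _ _
    rw [e, Fin.prod_univ_succ, Fin.sum_univ_succ] at this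
    refine le_trans (le_of_eq ?_) this
    have e0 : Fin.take ((0 : Fin (m + 1 + 1)) : ℕ) (0 : Fin (m + 1 + 1)).isLt.le
        (Fin.cons a h : Fin (m + 1 + 1) → A) = Fin.elim0 := funext fun i => i.elim0
    have e1 (t : Fin (m + 1)) :
        Fin.take (t.succ : ℕ) t.succ.isLt.le (Fin.cons a h : Fin (m + 1 + 1) → A) =
        (Fin.cons a (Fin.take t t.isLt.le h) : Fin (t + 1) → A) :=
      Fin.take_succ_cons _ _ _ _
    simp_rw [e0, e1, ← Fin.succ_castSucc, Fin.castSucc_zero, Fin.cons_zero, Fin.cons_succ]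
    rw [← mul_assoc, ← add_assoc]
    rfl

theorem exists_bestPayoff_succ_eq [Fintype A] [Nonempty A] (G : StochGame K A B) {n : ℕ}
    (Y : Plan A B (n + 1)) (k : K) :
    ∃ a, G.bestPayoff (n + 1) Y k = (∑ b, G.M k a b * Y.first b) +
      ∑ k', G.Q a k k' * G.bestPayoff n (Y.shift a) k' := by
  obtain ⟨a, ha⟩ := exists_eq_ciSup_of_finite (f := fun a =>
    (∑ b, G.M k a b * Y.first b) + ∑ k', G.Q a k k' * G.bestPayoff n (Y.shift a) k')
  exact ⟨a, ha.symm⟩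

/-- Follow a maximizing action at each stage. Along it the recursion for `bestPayoff` is an
equality, so the flow constraints chain without any sign condition on `w`. -/
theorem IsFlowBound.bestPayoff_le [Fintype A] [Nonempty A] {G : StochGame K A B} {m : ℕ}
    {w : K → ℝ} {c : ℝ} {Y : Plan A B (m + 1)}
    {ell : (t : Fin (m + 1)) → (Fin (t + 1) → K) → (Fin t → A) → ℝ}
    (H : G.IsFlowBound m w c Y ell) (k : K) :
    w k * (c + G.bestPayoff (m + 1) Y k) ≤ ell 0 (fun _ => k) Fin.elim0 := by
  obtain ⟨a, ha⟩ := G.exists_bestPayoff_succ_eq Y k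
  rw [ha]
  induction m generalizing w c k a with
  | zero =>
    have := H.terminal (fun _ => k) (fun _ => a)
    have e : Fin.take 0 (Nat.le_succ 0) (fun _ : Fin 1 => a) = Fin.elim0 :=
      funext fun i => i.elim0
    have e' : Fin.take ((0 : Fin 1) : ℕ) (0 : Fin 1).isLt.le (fun _ : Fin 1 => a) = Fin.elim0 :=
      funext fun i => i.elim0
    rw [e, Fin.sum_univ_one, e'] at this
    simp only [Finset.univ_eq_empty, Finset.prod_empty, mul_one] at this
    simpa [bestPayoff, Plan.first] using this
  | succ m ih =>
    -- Splitting the left side over the next state matches it term by term with the flow constraint.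
    rw [← sum_transition_mul]
    have hflow := H.flow 0 (fun _ => k) (fun _ => a)
    have e : Fin.take ((0 : Fin (m + 1)) : ℕ) (Nat.le_succ _) (fun _ : Fin 1 => a) = Fin.elim0 :=
      funext fun i => i.elim0
    refine le_trans (Finset.sum_le_sum fun k' _ => ?_) (hflow.trans_eq (congrArg (ell 0 (fun _ => k)) e :))
    obtain ⟨a', ha'⟩ := G.exists_bestPayoff_succ_eq (Y.shift a) k'
    have := ih (H.shift k a) k' a' ha'
    rw [← ha'] at this
    refine this.trans_eq ?_
    have e1 : (Fin.cons a Fin.elim0 : Fin 1 → A) = fun _ => a := by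
      funext i; fin_cases i; rfl
    have e2 := Fin.snoc_const_eq_cons k k'
    exact (congrArg₂ (ell 1) e2.symm e1 :)

/-- The bound of `IsFlowBound.bestPayoff_le` is sharp: take for each `ℓ` the weight of the history
times past payoff plus best continuation. Here every action must be dominated, which uses `0 ≤ w`.
-/
theorem exists_isFlowBound [Fintype A] [Nonempty A] (G : StochGame K A B) {m : ℕ}
    {w : K → ℝ} (hw : ∀ k, 0 ≤ w k) (c : ℝ) (Y : Plan A B (m + 1)) :
    ∃ ell : (t : Fin (m + 1)) → (Fin (t + 1) → K) → (Fin t → A) → ℝ,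
      G.IsFlowBound m w c Y ell ∧
        ∀ k, ell 0 (fun _ => k) Fin.elim0 = w k * (c + G.bestPayoff (m + 1) Y k) := by
  induction m generalizing w c with
  | zero =>
    refine ⟨fun _ κ _ => w (κ 0) * (c + G.bestPayoff 1 Y (κ 0)), ⟨fun t => t.elim0, fun κ h => ?_⟩,
      fun k => rfl⟩
    have e : Fin.take ((0 : Fin 1) : ℕ) (0 : Fin 1).isLt.le h = Fin.elim0 :=
      funext fun i => i.elim0
    rw [Fin.sum_univ_one, e]
    simp only [Finset.univ_eq_empty, Finset.prod_empty, mul_one]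
    refine mul_le_mul_of_nonneg_left (add_le_add_right ?_ _) (hw _)
    refine le_trans (le_of_eq ?_) (G.le_bestPayoff_succ Y (κ 0) (h 0))
    simp [bestPayoff, Plan.first]
  | succ m ih =>
    choose ell hell hinit using fun k a => ih (w := fun k' => w k * G.Q a k k')
      (fun k' => mul_nonneg (hw k) ((G.Q_mem a k).1 k')) (c + ∑ b, G.M k a b * Y.first b)
      (Y.shift a)
    refine ⟨fun t => Fin.cases
      (motive := fun t : Fin (m + 1 + 1) => (Fin (t + 1) → K) → (Fin t → A) → ℝ)
      (fun κ _ => w (κ 0) * (c + G.bestPayoff (m + 1 + 1) Y (κ 0)))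
      (fun t κ h => ell (κ 0) (h ⟨0, Nat.succ_pos t⟩) t (fun i => κ i.succ) (fun i => h i.succ)) t,
      ⟨fun t => ?_, fun κ h => ?_⟩, fun k => rfl⟩
    · refine Fin.cases (fun κ h => ?_) (fun t κ h => ?_) t
      · change ∑ k', ell (κ 0) (h 0) 0 (fun i : Fin 1 => (Fin.snoc κ k' : Fin 2 → K) i.succ)
          (fun i : Fin 0 => h i.succ) ≤ w (κ 0) * (c + G.bestPayoff (m + 1 + 1) Y (κ 0))
        have e1 (k' : K) : (fun i : Fin 1 => (Fin.snoc κ k' : Fin 2 → K) i.succ) = fun _ => k' := by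
          funext i; fin_cases i; rfl
        have e2 : (fun i : Fin 0 => h i.succ) = Fin.elim0 := funext fun i => i.elim0
        refine (Finset.sum_congr rfl fun k' _ => (congrArg₂ (ell (κ 0) (h 0) 0) (e1 k') e2).trans
          (hinit _ _ k')).trans_le ?_
        rw [sum_transition_mul]
        exact mul_le_mul_of_nonneg_left (add_le_add_right (G.le_bestPayoff_succ Y _ _) _) (hw _)
      · have := (hell (κ 0) (h 0)).flow t (fun i => κ i.succ) (fun i => h i.succ)
        simp_rw [← Fin.snoc_comp_succ] at this
        exact this
    · refine le_trans (le_of_eq ?_)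
        ((hell (κ 0) (h 0)).terminal (fun i => κ i.succ) (fun i => h i.succ))
      rw [Fin.prod_univ_succ, Fin.sum_univ_succ]
      have e0 : Fin.take ((0 : Fin (m + 1 + 1)) : ℕ) (0 : Fin (m + 1 + 1)).isLt.le h = Fin.elim0 :=
        funext fun i => i.elim0
      have e1 (t : Fin (m + 1)) : Fin.take (t.succ : ℕ) t.succ.isLt.le h =
          (Fin.cons (h 0) (Fin.take t t.isLt.le fun i => h i.succ) : Fin (t + 1) → A) := by
        rw [← Fin.take_succ_cons (h := t.succ.isLt.le)]
        exact congrArg _ (Fin.cons_self_tail h).symm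
      simp_rw [e0, e1]
      rw [← mul_assoc, ← add_assoc]
      rfl

end StochGame

/-! ### The linear program -/

namespace StochGame

variable {K A B : Type*} [Fintype K] [Fintype B]

theorem mem_feasible_regretLP (G : StochGame K A B) (m : ℕ) (α : K → ℝ)
    (x : RegretVar K A B m → ℝ) :
    x ∈ (G.regretLP m α).feasible ↔
      (∀ a k, (∑ b, G.M k a b * x (.yhat b)) + α k - (∑ k', G.Q a k k' * x (.beta a k'))
        + x (.lhat a) ≤ x .ltilde) ∧
      (∀ a k, x (.beta a k) + x (.ell a 0 (fun _ => k) Fin.elim0) ≤ x (.lhat a)) ∧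
      (∀ a, G.IsFlowBound m (fun _ => 1) 0 (fun t h b => x (.y a t h b))
        (fun t κ h => x (.ell a t κ h))) ∧
      (fun b => x (.yhat b)) ∈ stdSimplex ℝ B ∧
      ∀ a, Plan.IsMixed fun t h b => x (.y a t h b) := by
  constructor
  · rintro ⟨hi, he⟩
    refine ⟨fun a k => ?_, fun a k => ?_, fun a => ⟨fun t κ h => ?_, fun κ h => ?_⟩,
      ⟨fun b => ?_, ?_⟩, fun a t h => ⟨fun b => ?_, ?_⟩⟩
    · have := hi (.current a k)
      simp [regretLP] at this
      linarith
    · have := hi (.initial a k)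
      simp [regretLP] at this
      exact this
    · have := hi (.flow a t κ h)
      simpa [regretLP] using this
    · have := hi (.terminal a κ h)
      simpa [regretLP] using this
    · simpa [regretLP] using hi (.yhat_nonneg b)
    · simpa [regretLP] using he .yhat_sum
    · simpa [regretLP] using hi (.y_nonneg a t h b)
    · simpa [regretLP] using he (.y_sum a t h)
  · rintro ⟨h1, h2, h3, h4, h5⟩
    refine ⟨?_, ?_⟩
    · rintro (⟨a, k⟩ | ⟨a, k⟩ | ⟨a, t, κ, h⟩ | ⟨a, κ, h⟩ | b | ⟨a, t, h, b⟩)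
      · have := h1 a k
        simp [regretLP]
        linarith
      · have := h2 a k
        simp [regretLP]
        exact this
      · simpa [regretLP] using (h3 a).flow t κ h
      · simpa [regretLP] using (h3 a).terminal κ h
      · simpa [regretLP] using h4.1 b
      · simpa [regretLP] using (h5 a t h).1 b
    · rintro (_ | ⟨a, t, h⟩)
      · simpa [regretLP] using h4.2
      · simpa [regretLP] using (h5 a t h).2

variable [Fintype A]

theorem le_updateObjective (G : StochGame K A B) {n : ℕ} [NeZero n] (α : K → ℝ) (y : B → ℝ)
    (β : A → K → ℝ) (a : A) (k : K) :
    (∑ b, G.M k a b * y b) + α k - (∑ k', G.Q a k k' * β a k') + G.dualValue n (β a) ≤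
      G.updateObjective n α y β := by
  classical
  let f (x : K × A) : ℝ := (∑ b, G.M x.1 x.2 b * y b) + α x.1
    - (∑ k', G.Q x.2 x.1 k' * β x.2 k') + G.dualValue n (β x.2)
  have hsum (P : stdSimplex ℝ (K × A)) : ∑ k, ∑ a, P.1 (k, a) * f (k, a) = ∑ x, P.1 x * f x :=
    (Fintype.sum_prod_type (f := fun x => P.1 x * f x)).symm
  obtain ⟨C, hC⟩ := (Set.finite_range f).bddAbove
  have hbdd : BddAbove (Set.range fun P : stdSimplex ℝ (K × A) =>
      ∑ k, ∑ a, P.1 (k, a) * f (k, a)) := by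
    refine ⟨C, ?_⟩
    rintro _ ⟨P, rfl⟩
    dsimp only
    rw [hsum]
    exact sum_mul_le_of_mem_stdSimplex P.2 fun x => hC ⟨x, rfl⟩
  refine le_trans (le_of_eq ?_) (le_ciSup hbdd ⟨Pi.single (k, a) 1, single_mem_stdSimplex ℝ _⟩)
  refine Eq.trans ?_ (hsum _).symm
  rw [Finset.sum_eq_single (k, a)]
  · simp [f]
  · intro x _ hx
    simp [hx]
  · simp

variable [Nonempty A]

/-- Continuing with plans `Y a` after the first mixed action `y` guarantees `c` if continuation
payoffs are bounded in terms of vector payoffs `β a`. -/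
theorem add_bestPayoff_cons_le (G : StochGame K A B) {n : ℕ} {α : K → ℝ} {y : B → ℝ}
    {Y : A → Plan A B n} {β : A → K → ℝ} {l : A → ℝ} {c : ℝ}
    (hl : ∀ a k, β a k + G.bestPayoff n (Y a) k ≤ l a)
    (hc : ∀ a k, (∑ b, G.M k a b * y b) + α k - (∑ k', G.Q a k k' * β a k') + l a ≤ c) (k : K) :
    α k + G.bestPayoff (n + 1) (Plan.cons y Y) k ≤ c := by
  obtain ⟨a, ha⟩ := G.exists_bestPayoff_succ_eq (Plan.cons y Y) k
  rw [ha, Plan.first_cons, Plan.shift_cons]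
  -- Averaged over the next state, the bound contains the same `∑ k', G.Q a k k' * β a k'` that `hc`
  -- subtracts, so it cancels.
  have := sum_mul_le_of_mem_stdSimplex (G.Q_mem a k) (hl a)
  simp_rw [mul_add, Finset.sum_add_distrib] at this
  linarith [hc a k]

theorem le_of_mem_feasible_regretLP (G : StochGame K A B) {m : ℕ} {α : K → ℝ}
    {x : RegretVar K A B m → ℝ} (hx : x ∈ (G.regretLP m α).feasible) (a : A) (k : K) :
    x (.beta a k) + G.bestPayoff (m + 1) (fun t h b => x (.y a t h b)) k ≤ x (.lhat a) := by
  obtain ⟨-, h2, h3, -, -⟩ := (G.mem_feasible_regretLP m α x).1 hx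
  have := (h3 a).bestPayoff_le k
  simp only [one_mul, zero_add] at this
  linarith [h2 a k]

variable [Nonempty K]

theorem updateObjective_le (G : StochGame K A B) {n : ℕ} [NeZero n] {α : K → ℝ} {y : B → ℝ}
    {β : A → K → ℝ} {c : ℝ}
    (hc : ∀ a k, (∑ b, G.M k a b * y b) + α k - (∑ k', G.Q a k k' * β a k')
      + G.dualValue n (β a) ≤ c) : G.updateObjective n α y β ≤ c := by
  refine ciSup_le fun P => ?_
  rw [← Fintype.sum_prod_type (f := fun x : K × A => P.1 x * ((∑ b, G.M x.1 x.2 b * y b) + α x.1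
    - (∑ k', G.Q x.2 x.1 k' * β x.2 k') + G.dualValue n (β x.2)))]
  exact sum_mul_le_of_mem_stdSimplex P.2 fun x => hc x.2 x.1

variable [Nonempty B]

theorem dualValue_le_objective (G : StochGame K A B) {m : ℕ} {α : K → ℝ}
    {x : RegretVar K A B m → ℝ} (hx : x ∈ (G.regretLP m α).feasible) :
    G.dualValue (m + 2) α ≤ x .ltilde := by
  obtain ⟨h1, -, -, h4, h5⟩ := (G.mem_feasible_regretLP m α x).1 hx
  exact G.dualValue_le (Plan.IsMixed.cons h4 h5)
    (G.add_bestPayoff_cons_le (G.le_of_mem_feasible_regretLP hx) h1)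

theorem exists_mem_feasible_regretLP (G : StochGame K A B) (m : ℕ) (α : K → ℝ) :
    ∃ x ∈ (G.regretLP m α).feasible, x .ltilde = G.dualValue (m + 2) α := by
  obtain ⟨-, Y, hY, hbest⟩ := G.exists_isMixed_hasValue (m + 1) α
  choose ell hell hinit using fun a =>
    G.exists_isFlowBound (w := fun _ => 1) (fun _ => zero_le_one) 0 (Y.shift a)
  -- With `β_a = -bestPayoff`, the `initial` constraints are equalities for `ℓ̂_a = 0`, and
  -- `current` becomes the one-step inequality for `bestPayoff`.
  let x : RegretVar K A B m → ℝ
    | .yhat b => Y.first b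
    | .beta a k => - G.bestPayoff (m + 1) (Y.shift a) k
    | .ltilde => G.dualValue (m + 2) α
    | .lhat _ => 0
    | .y a t h b => Y.shift a t h b
    | .ell a t κ h => ell a t κ h
  refine ⟨x, (G.mem_feasible_regretLP m α x).2
    ⟨fun a k => ?_, fun a k => ?_, hell, hY.first, hY.shift⟩, rfl⟩
  · have h1 := hbest k
    have h2 := G.le_bestPayoff_succ Y k a
    simp only [x, mul_neg, Finset.sum_neg_distrib]
    linarith
  · refine (congrArg (x (.beta a k) + ·) (hinit a k)).trans_le ?_
    simp [x]

theorem isLeast_regretLP (G : StochGame K A B) (m : ℕ) (α : K → ℝ) :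
    IsLeast ((G.regretLP m α).objective '' (G.regretLP m α).feasible)
      (G.dualValue (m + 2) α) := by
  obtain ⟨x, hx, hval⟩ := G.exists_mem_feasible_regretLP m α
  refine ⟨⟨x, hx, hval⟩, ?_⟩
  rintro _ ⟨x', hx', rfl⟩
  exact G.dualValue_le_objective hx'

theorem ltilde_eq_of_isOptimal (G : StochGame K A B) {m : ℕ} {α : K → ℝ}
    {x : RegretVar K A B m → ℝ} (hx : (G.regretLP m α).IsOptimal x) :
    x .ltilde = G.dualValue (m + 2) α := by
  obtain ⟨x', hx', hval⟩ := G.exists_mem_feasible_regretLP m α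
  exact le_antisymm ((hx.2 x' hx').trans_eq hval) (G.dualValue_le_objective hx.1)

/-! ### Security strategies in the primal game -/

/-- Replace `τ` by an equivalent plan `Y` and put `α' = -bestPayoff Y`. Then `w(α') ≤ 0`, while a
blind best response earns `-pᵀα'`; this is at least `w(α') - pᵀα'`, which the regret `α` minimizes.
-/
theorem dualValue_sub_le_primalPayoff (G : StochGame K A B) {n : ℕ} {p : stdSimplex ℝ K}
    {α : K → ℝ} (hα : G.IsInitialRegret (n + 1) p α) :
    G.dualValue (n + 1) α - ∑ k, p.1 k * α k ≤ upperValue (G.primalPayoff (n + 1) p) := by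
  refine le_ciInf fun τ => ?_
  obtain ⟨Y, hY, hpay⟩ := G.exists_isMixed_totalPayoff_eq τ
  obtain ⟨σ, hσ⟩ := G.exists_blindPayoff_eq_bestPayoff Y
  refine le_trans ?_ (le_ciSup (G.bddAbove_primalPayoff (n + 1) p τ) (σ.toInformed B))
  have h0 : G.dualValue (n + 1) (fun k => - G.bestPayoff (n + 1) Y k) ≤ 0 :=
    G.dualValue_le hY fun k => (neg_add_cancel _).le
  have h1 := hα fun k => - G.bestPayoff (n + 1) Y k
  simp only [mul_neg, Finset.sum_neg_distrib] at h1
  simp_rw [primalPayoff_eq, hpay, hσ]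
  linarith

theorem isSecurityStrategy_primalPayoff (G : StochGame K A B) {n : ℕ} {p : stdSimplex ℝ K}
    {α : K → ℝ} (hα : G.IsInitialRegret (n + 1) p α) {τ : UninformedStrategy A B (n + 1)}
    (hτ : IsSecurityStrategy (G.dualPayoff (n + 1) α) τ) :
    IsSecurityStrategy (G.primalPayoff (n + 1) p) τ := by
  intro σ
  have h1 := hτ (p, σ)
  have h2 := G.dualValue_sub_le_primalPayoff hα
  rw [dualPayoff_eq] at h1
  rw [primalPayoff_eq]
  rw [dualValue] at h2
  linarith

/-! ### Regret updates and security strategies from optimal solutions -/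

theorem dualValue_le_updateObjective (G : StochGame K A B) {m : ℕ} (α : K → ℝ) {y : B → ℝ}
    (hy : y ∈ stdSimplex ℝ B) (β : A → K → ℝ) :
    G.dualValue (m + 2) α ≤ G.updateObjective (m + 1) α y β := by
  choose Y hY hbest using fun a => (G.exists_isMixed_hasValue m (β a)).2
  exact G.dualValue_le (Plan.IsMixed.cons hy hY)
    (G.add_bestPayoff_cons_le hbest (G.le_updateObjective α y β))

/-- The plan `y_a` shows that the dual value at `β_a` is at most `ℓ̂_a`. The objective is therefore
at most `ℓ̃`, the dual value, which bounds every objective value from below. -/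
theorem isRegretUpdate_of_isOptimal (G : StochGame K A B) {m : ℕ} {α : K → ℝ}
    {x : RegretVar K A B m → ℝ} (hx : (G.regretLP m α).IsOptimal x) :
    G.IsRegretUpdate (m + 1) α (fun b => x (.yhat b)) (fun a k => x (.beta a k)) := by
  obtain ⟨h1, -, -, h4, h5⟩ := (G.mem_feasible_regretLP m α x).1 hx.1
  refine ⟨h4, fun y hy β => ?_⟩
  refine le_trans (G.updateObjective_le fun a k => ?_) (G.dualValue_le_updateObjective α hy β)
  rw [← G.ltilde_eq_of_isOptimal hx]
  exact (add_le_add_right (G.dualValue_le (h5 a) (G.le_of_mem_feasible_regretLP hx.1 a)) _).trans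
    (h1 a k)

theorem exists_isSecurityStrategy_of_isOptimal (G : StochGame K A B) {m : ℕ} {α : K → ℝ}
    {x : RegretVar K A B m → ℝ} (hx : (G.regretLP m α).IsOptimal x) :
    ∃ τ : UninformedStrategy A B (m + 2), (∀ h j b, (τ 0 h j).1 b = x (.yhat b)) ∧
      IsSecurityStrategy (G.dualPayoff (m + 2) α) τ := by
  obtain ⟨h1, -, -, h4, h5⟩ := (G.mem_feasible_regretLP m α x).1 hx.1
  refine ⟨(Plan.IsMixed.cons h4 h5).toStrategy, fun _ _ _ => rfl, fun s => ?_⟩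
  refine (G.dualPayoff_toStrategy_le (m + 1) α _
    (G.add_bestPayoff_cons_le (G.le_of_mem_feasible_regretLP hx.1) h1) s).trans_eq ?_
  exact G.ltilde_eq_of_isOptimal hx

end StochGame

/-! ### The size of the linear program -/

/-- The variables as a sum type. -/
def RegretVar.equivSum (K A B : Type*) (m : ℕ) : RegretVar K A B m ≃
    B ⊕ (A × K) ⊕ Unit ⊕ A ⊕ (A × (Σ t : Fin (m + 1), (Fin t → A)) × B) ⊕
      (A × Σ t : Fin (m + 1), (Fin (t + 1) → K) × (Fin t → A)) where
  toFun
    | .yhat b => .inl b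
    | .beta a k => .inr (.inl (a, k))
    | .ltilde => .inr (.inr (.inl ()))
    | .lhat a => .inr (.inr (.inr (.inl a)))
    | .y a t h b => .inr (.inr (.inr (.inr (.inl (a, ⟨t, h⟩, b)))))
    | .ell a t κ h => .inr (.inr (.inr (.inr (.inr (a, ⟨t, κ, h⟩)))))
  invFun
    | .inl b => .yhat b
    | .inr (.inl (a, k)) => .beta a k
    | .inr (.inr (.inl ())) => .ltilde
    | .inr (.inr (.inr (.inl a))) => .lhat a
    | .inr (.inr (.inr (.inr (.inl (a, ⟨t, h⟩, b))))) => .y a t h b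
    | .inr (.inr (.inr (.inr (.inr (a, ⟨t, κ, h⟩))))) => .ell a t κ h
  left_inv := by rintro (_ | _ | _ | _ | _ | _) <;> rfl
  right_inv := by
    rintro (_ | ⟨_, _⟩ | _ | _ | ⟨_, ⟨_, _⟩, _⟩ | ⟨_, _, _, _⟩) <;> rfl

/-- The inequality constraints as a sum type. -/
def RegretIneq.equivSum (K A B : Type*) (m : ℕ) : RegretIneq K A B m ≃
    (A × K) ⊕ (A × K) ⊕ (A × Σ t : Fin m, (Fin (t + 1) → K) × (Fin (t + 1) → A)) ⊕
      (A × (Fin (m + 1) → K) × (Fin (m + 1) → A)) ⊕ B ⊕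
        (A × (Σ t : Fin (m + 1), (Fin t → A)) × B) where
  toFun
    | .current a k => .inl (a, k)
    | .initial a k => .inr (.inl (a, k))
    | .flow a t κ h => .inr (.inr (.inl (a, ⟨t, κ, h⟩)))
    | .terminal a κ h => .inr (.inr (.inr (.inl (a, κ, h))))
    | .yhat_nonneg b => .inr (.inr (.inr (.inr (.inl b))))
    | .y_nonneg a t h b => .inr (.inr (.inr (.inr (.inr (a, ⟨t, h⟩, b)))))
  invFun
    | .inl (a, k) => .current a k
    | .inr (.inl (a, k)) => .initial a k
    | .inr (.inr (.inl (a, ⟨t, κ, h⟩))) => .flow a t κ h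
    | .inr (.inr (.inr (.inl (a, κ, h)))) => .terminal a κ h
    | .inr (.inr (.inr (.inr (.inl b)))) => .yhat_nonneg b
    | .inr (.inr (.inr (.inr (.inr (a, ⟨t, h⟩, b))))) => .y_nonneg a t h b
  left_inv := by rintro (_ | _ | _ | _ | _ | _) <;> rfl
  right_inv := by
    rintro (⟨_, _⟩ | ⟨_, _⟩ | ⟨_, _, _, _⟩ | ⟨_, _, _⟩ | _ | ⟨_, ⟨_, _⟩, _⟩) <;> rfl

/-- The equality constraints as a sum type. -/
def RegretEqn.equivSum (A : Type*) (m : ℕ) :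
    RegretEqn A m ≃ Unit ⊕ (A × Σ t : Fin (m + 1), (Fin t → A)) where
  toFun
    | .yhat_sum => .inl ()
    | .y_sum a t h => .inr (a, ⟨t, h⟩)
  invFun
    | .inl () => .yhat_sum
    | .inr (a, ⟨t, h⟩) => .y_sum a t h
  left_inv := by rintro (_ | _) <;> rfl
  right_inv := by rintro (_ | ⟨_, _, _⟩) <;> rfl

theorem RegretVar.natCard (K A B : Type*) [Fintype K] [Fintype A] [Fintype B] (m : ℕ) :
    Nat.card (RegretVar K A B m) =
      (1 + Nat.card A * ∑ t ∈ Finset.range (m + 1), Nat.card A ^ t) * Nat.card B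
        + (Nat.card A * Nat.card K + 1 + Nat.card A
          + Nat.card A * ∑ t ∈ Finset.range (m + 1), Nat.card K ^ (t + 1) * Nat.card A ^ t) := by
  classical
  rw [Nat.card_congr (RegretVar.equivSum K A B m)]
  simp only [Nat.card_eq_fintype_card, Fintype.card_sum, Fintype.card_prod, Fintype.card_sigma,
    Fintype.card_fun, Fintype.card_fin, Fintype.card_unit,
    Fin.sum_univ_eq_sum_range (fun t => Fintype.card A ^ t),
    Fin.sum_univ_eq_sum_range (fun t => Fintype.card K ^ (t + 1) * Fintype.card A ^ t)]
  ring

theorem natCard_regretIneq_add_natCard_regretEqn (K A B : Type*) [Fintype K] [Fintype A]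
    [Fintype B] (m : ℕ) :
    Nat.card (RegretIneq K A B m) + Nat.card (RegretEqn A m) =
      (1 + Nat.card A * ∑ t ∈ Finset.range (m + 1), Nat.card A ^ t) * Nat.card B
        + (2 * (Nat.card A * Nat.card K)
          + Nat.card A * ∑ t ∈ Finset.range (m + 1), (Nat.card K * Nat.card A) ^ (t + 1)
          + 1 + Nat.card A * ∑ t ∈ Finset.range (m + 1), Nat.card A ^ t) := by
  classical
  rw [Nat.card_congr (RegretIneq.equivSum K A B m), Nat.card_congr (RegretEqn.equivSum A m)]
  simp only [Nat.card_eq_fintype_card, Fintype.card_sum, Fintype.card_prod, Fintype.card_sigma,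
    Fintype.card_fun, Fintype.card_fin, Fintype.card_unit, ← mul_pow,
    Fin.sum_univ_eq_sum_range (fun t => Fintype.card A ^ t),
    Fin.sum_univ_eq_sum_range (fun t => (Fintype.card K * Fintype.card A) ^ (t + 1))]
  -- The terminal constraints supply the last term of the sum, the flow constraints the others.
  rw [Finset.sum_range_succ (fun t => (Fintype.card K * Fintype.card A) ^ (t + 1))]
  ring

/-- Here `n = m + 1 ≥ 1` is the number of stages after the current one, so that the game under
consideration has `n + 1 = m + 2` stages. -/
theorem mainTheorem5 {K A B : Type*} [Fintype K] [Fintype A] [Fintype B] [Nonempty A] [Nonempty B]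
    (G : StochGame K A B) (m : ℕ) (p : stdSimplex ℝ K) (α₁ : K → ℝ)
    (hα₁ : G.IsInitialRegret (m + 2) p α₁) :
    -- the dual value is the value of the dual game and the optimum of the linear program
    HasValue (G.dualPayoff (m + 2) α₁) (G.dualValue (m + 2) α₁) ∧
    IsLeast ((G.regretLP m α₁).objective '' (G.regretLP m α₁).feasible)
      (G.dualValue (m + 2) α₁) ∧
    -- for every optimal solution, `ŷ` is a current-stage security strategy of player 2 (in the
    -- dual and in the primal game) and `β a` is the next-stage regret after action `a`
    (∀ x, (G.regretLP m α₁).IsOptimal x →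
      (∃ τ : UninformedStrategy A B (m + 2),
        (∀ h j b, (τ 0 h j).1 b = x (.yhat b)) ∧
        IsSecurityStrategy (G.dualPayoff (m + 2) α₁) τ ∧
        IsSecurityStrategy (G.primalPayoff (m + 2) p) τ) ∧
      G.IsRegretUpdate (m + 1) α₁ (fun b => x (.yhat b)) (fun a k => x (.beta a k))) ∧
    -- the numbers of variables and of constraints are affine functions of the size of `B`
    Nat.card (RegretVar K A B m) =
      (1 + Nat.card A * ∑ t ∈ Finset.range (m + 1), Nat.card A ^ t) * Nat.card B
        + (Nat.card A * Nat.card K + 1 + Nat.card A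
          + Nat.card A * ∑ t ∈ Finset.range (m + 1), Nat.card K ^ (t + 1) * Nat.card A ^ t) ∧
    Nat.card (RegretIneq K A B m) + Nat.card (RegretEqn A m) =
      (1 + Nat.card A * ∑ t ∈ Finset.range (m + 1), Nat.card A ^ t) * Nat.card B
        + (2 * (Nat.card A * Nat.card K)
          + Nat.card A * ∑ t ∈ Finset.range (m + 1), (Nat.card K * Nat.card A) ^ (t + 1)
          + 1 + Nat.card A * ∑ t ∈ Finset.range (m + 1), Nat.card A ^ t) := by
  have hK : Nonempty K := by
    by_contra h
    have := not_nonempty_iff.1 h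
    simpa using p.2.2
  refine ⟨(G.exists_isMixed_hasValue (m + 1) α₁).1, G.isLeast_regretLP m α₁, fun x hx => ?_,
    RegretVar.natCard K A B m, natCard_regretIneq_add_natCard_regretEqn K A B m⟩
  obtain ⟨τ, hfirst, hdual⟩ := G.exists_isSecurityStrategy_of_isOptimal hx
  exact ⟨⟨τ, hfirst, hdual, G.isSecurityStrategy_primalPayoff hα₁ hdual⟩,
    G.isRegretUpdate_of_isOptimal hx⟩
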